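/- Let $R$ be the countable universal graph (the Fraïssé limit of the class of finite simple graphs, i.e. the countable graph in which every finite graph embeds as an induced subgraph and in which every isomorphism between finite induced subgraphs extends to an automorphism), and let $V$ be its vertex set. Call a graph algebraically closed if for every finite set $A$ of its vertices some vertex is adjacent to every member of $A$. Let $\operatorname{End} R$ be the monoid of graph endomorphisms of $R$, with maps written on the right, so that $fg$ means first $f$, then $g$; an element $f$ of a monoid $M$ is regular if $fgf=f$ for some $g\in M$. Green's relations on $M$ are: $f\,\mathscr{L}\,g$ if $Mf=Mg$; $f\,\mathscr{R}\,g$ if $fM=gM$; and $\mathscr{D}=\mathscr{L}\circ\mathscr{R}$. Theorem. Let $\Gamma$ be any countable algebraically closed graph that is not isomorphic to $R$. Then there exists a non-regular injective endomorphism $f$ of $R$ such that the subgraph $\langle Vf\rangle$ of $R$ induced on the image $Vf=\{vf : v\in V\}$ of the vertex set is isomorphic to $\Gamma$, and such that the $\mathscr{D}$-class of $f$ in $\operatorname{End} R$ contains exactly $2^{\aleph_0}$ many $\mathscr{R}$-classes and exactly $2^{\aleph_0}$ many $\mathscr{L}$-classes. -/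

import Mathlib

/-- A graph is algebraically closed if every finite set of vertices has a common neighbour. -/
def IsAlgClosedGraph {W : Type*} (Γ : SimpleGraph W) : Prop :=
  ∀ A : Finset W, ∃ w : W, ∀ a ∈ A, Γ.Adj w a

/-- `R` is (a copy of) the countable universal homogeneous graph, the Fraïssé limit of the class
of finite graphs: it is countable, every finite graph embeds in it as an induced subgraph, and
every isomorphism between finite induced subgraphs extends to an automorphism. -/
structure IsCountableUniversalGraph {V : Type*} (R : SimpleGraph V) : Prop where
  countable : Countable V
  universal : ∀ (n : ℕ) (H : SimpleGraph (Fin n)), Nonempty (H ↪g R)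
  homogeneous : ∀ (A B : Finset V) (φ : R.induce (A : Set V) ≃g R.induce (B : Set V)),
    ∃ ψ : R ≃g R, ∀ a : ↥(A : Set V), ψ (a : V) = (φ a : V)

/-- The endomorphism monoid of a graph, with maps written on the right: `f * g` is
"first `f`, then `g`", so it is the opposite of the monoid of endomorphisms under composition. -/
abbrev GraphEnd {V : Type*} (R : SimpleGraph V) : Type _ := (R →g R)ᵐᵒᵖ

/-- The product in `GraphEnd R` is composition from left to right. -/
theorem GraphEnd.mul_apply {V : Type*} {R : SimpleGraph V} (f g : GraphEnd R) (v : V) :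
    (f * g).unop v = g.unop (f.unop v) := rfl

section Green

variable {M : Type*} [Monoid M]

/-- Green's relation `L`: equal principal left ideals, `M f = M g`. -/
def GreenL (f g : M) : Prop :=
  Set.range (fun m : M => m * f) = Set.range (fun m : M => m * g)

/-- Green's relation `R`: equal principal right ideals, `f M = g M`. -/
def GreenR (f g : M) : Prop :=
  Set.range (fun m : M => f * m) = Set.range (fun m : M => g * m)

/-- Green's relation `D`, the composite `L ∘ R`. -/
def GreenD (f g : M) : Prop :=
  Relation.Comp GreenL GreenR f g

/-- (Von Neumann) regular elements of a monoid. -/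
def IsRegularElt (f : M) : Prop :=
  ∃ g : M, f * g * f = f

/-- The set of `L`-classes contained in the `D`-class of `f`. -/
def lClassesOfDClass (f : M) : Set (Set M) :=
  {C | ∃ g : M, GreenD f g ∧ C = {h | GreenL g h}}

/-- The set of `R`-classes contained in the `D`-class of `f`. -/
def rClassesOfDClass (f : M) : Set (Set M) :=
  {C | ∃ g : M, GreenD f g ∧ C = {h | GreenR g h}}

end Green

/-! The remainder shows that the countable universal graph exists. -/

namespace CountableUniversalGraph

/-- The one-point extension property. -/
def Ext {W : Type*} (H : SimpleGraph W) : Prop :=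
  ∀ A B : Finset W, Disjoint A B →
    ∃ z, z ∉ A ∧ z ∉ B ∧ (∀ a ∈ A, H.Adj a z) ∧ ∀ b ∈ B, ¬ H.Adj b z

/-- Finite partial isomorphisms, as finite sets of pairs. -/
def PIso {V W : Type*} (G : SimpleGraph V) (H : SimpleGraph W) : Type _ :=
  {f : Finset (V × W) // ∀ p ∈ f, ∀ q ∈ f,
    (p.1 = q.1 ↔ p.2 = q.2) ∧ (G.Adj p.1 q.1 ↔ H.Adj p.2 q.2)}

instance {V W : Type*} (G : SimpleGraph V) (H : SimpleGraph W) : Preorder (PIso G H) :=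
  inferInstanceAs (Preorder {f : Finset (V × W) // ∀ p ∈ f, ∀ q ∈ f,
    (p.1 = q.1 ↔ p.2 = q.2) ∧ (G.Adj p.1 q.1 ↔ H.Adj p.2 q.2)})

theorem forth {V W : Type*} {G : SimpleGraph V} {H : SimpleGraph W} (hH : Ext H)
    (f : PIso G H) (a : V) : ∃ g : PIso G H, (∃ b, (a, b) ∈ g.1) ∧ f ≤ g := by
  classical
  by_cases h : ∃ b, (a, b) ∈ f.1
  · exact ⟨f, h, le_rfl⟩
  push Not at h
  obtain ⟨z, hzA, hzB, hA, hB⟩ := hH ((f.1.filter fun p => G.Adj p.1 a).image Prod.snd)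
    ((f.1.filter fun p => ¬ G.Adj p.1 a).image Prod.snd) (by
      rw [Finset.disjoint_left]
      simp only [Finset.mem_image, Finset.mem_filter, not_exists, not_and]
      rintro _ ⟨p, ⟨hp, hpa⟩, rfl⟩ q ⟨hq, hqa⟩ hqp
      exact hqa (((f.2 q hq p hp).1.2 hqp) ▸ hpa))
  have key : ∀ p ∈ f.1, p.1 ≠ a ∧ p.2 ≠ z ∧ (G.Adj p.1 a ↔ H.Adj p.2 z) := by
    intro p hp
    refine ⟨fun e => h p.2 (e ▸ hp), ?_, ?_⟩
    · rintro rfl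
      by_cases hpa : G.Adj p.1 a
      · exact hzA (Finset.mem_image_of_mem _ (Finset.mem_filter.2 ⟨hp, hpa⟩))
      · exact hzB (Finset.mem_image_of_mem _ (Finset.mem_filter.2 ⟨hp, hpa⟩))
    · constructor
      · intro hpa
        exact hA _ (Finset.mem_image_of_mem _ (Finset.mem_filter.2 ⟨hp, hpa⟩))
      · intro hz
        by_contra hpa
        exact hB _ (Finset.mem_image_of_mem _ (Finset.mem_filter.2 ⟨hp, hpa⟩)) hz
  refine ⟨⟨insert (a, z) f.1, fun p hp q hq => ?_⟩, ⟨z, Finset.mem_insert_self _ _⟩,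
    Finset.subset_insert _ _⟩
  rw [Finset.mem_insert] at hp hq
  rcases hp with rfl | hp <;> rcases hq with rfl | hq
  · simp
  · obtain ⟨h1, h2, h3⟩ := key q hq
    exact ⟨iff_of_false h1.symm h2.symm, by rw [G.adj_comm, H.adj_comm]; exact h3⟩
  · obtain ⟨h1, h2, h3⟩ := key p hp
    exact ⟨iff_of_false h1 h2, h3⟩
  · exact f.2 p hp q hq

/-- Exchange the two sides of a partial isomorphism. -/
def PIso.swap {V W : Type*} {G : SimpleGraph V} {H : SimpleGraph W} (f : PIso G H) : PIso H G :=
  ⟨f.1.map (Equiv.prodComm V W).toEmbedding, by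
    intro p hp q hq
    rw [Finset.mem_map_equiv] at hp hq
    have := f.2 _ hp _ hq
    exact ⟨this.1.symm, this.2.symm⟩⟩

theorem PIso.mem_swap {V W : Type*} {G : SimpleGraph V} {H : SimpleGraph W} (f : PIso G H)
    (p : W × V) : p ∈ f.swap.1 ↔ (p.2, p.1) ∈ f.1 := Finset.mem_map_equiv

theorem back {V W : Type*} {G : SimpleGraph V} {H : SimpleGraph W} (hG : Ext G)
    (f : PIso G H) (b : W) : ∃ g : PIso G H, (∃ a, (a, b) ∈ g.1) ∧ f ≤ g := by
  obtain ⟨g, ⟨a, ha⟩, hg⟩ := forth hG f.swap b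
  refine ⟨g.swap, ⟨a, (g.mem_swap _).2 ha⟩, fun p hp => (g.mem_swap _).2 (hg ?_)⟩
  exact (f.mem_swap _).2 hp

theorem exists_embedding {V W : Type*} [Countable V] {G : SimpleGraph V} {H : SimpleGraph W}
    (hH : Ext H) : Nonempty (G ↪g H) := by
  cases nonempty_encodable V
  let D : V → Order.Cofinal (PIso G H) := fun a =>
    ⟨{g | ∃ b, (a, b) ∈ g.1}, fun f => forth hH f a⟩
  let f₀ : PIso G H := ⟨∅, by simp⟩
  choose x hx hxI using Order.cofinal_meets_idealOfCofinals f₀ D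
  choose F hF using hx
  have hgood : ∀ a b, (a = b ↔ F a = F b) ∧ (G.Adj a b ↔ H.Adj (F a) (F b)) := by
    intro a b
    obtain ⟨m, -, h1, h2⟩ := (Order.idealOfCofinals f₀ D).directed _ (hxI a) _ (hxI b)
    exact m.2 _ (h1 (hF a)) _ (h2 (hF b))
  exact ⟨⟨⟨F, fun a b h => (hgood a b).1.2 h⟩, fun {a b} => (hgood a b).2.symm⟩⟩

theorem exists_iso {V W : Type*} [Countable V] [Countable W] {G : SimpleGraph V}
    {H : SimpleGraph W} (hG : Ext G) (hH : Ext H) (f₀ : PIso G H) :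
    ∃ ψ : G ≃g H, ∀ p ∈ f₀.1, ψ p.1 = p.2 := by
  cases nonempty_encodable V
  cases nonempty_encodable W
  let D : V ⊕ W → Order.Cofinal (PIso G H) := fun s => Sum.recOn s
    (fun a => ⟨{g | ∃ b, (a, b) ∈ g.1}, fun f => forth hH f a⟩)
    (fun b => ⟨{g | ∃ a, (a, b) ∈ g.1}, fun f => back hG f b⟩)
  choose x hx hxI using Order.cofinal_meets_idealOfCofinals f₀ D
  have hl : ∀ a : V, ∃ b, (a, b) ∈ (x (Sum.inl a)).1 := fun a => hx (Sum.inl a)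
  have hr : ∀ b : W, ∃ a, (a, b) ∈ (x (Sum.inr b)).1 := fun b => hx (Sum.inr b)
  choose F hF using hl
  choose K hK using hr
  have pair : ∀ g ∈ Order.idealOfCofinals f₀ D, ∀ g' ∈ Order.idealOfCofinals f₀ D,
      ∀ p ∈ g.1, ∀ q ∈ g'.1, (p.1 = q.1 ↔ p.2 = q.2) ∧ (G.Adj p.1 q.1 ↔ H.Adj p.2 q.2) := by
    intro g hg g' hg' p hp q hq
    obtain ⟨m, -, h1, h2⟩ := (Order.idealOfCofinals f₀ D).directed _ hg _ hg'
    exact m.2 _ (h1 hp) _ (h2 hq)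
  refine ⟨⟨⟨F, K, fun a => ?_, fun b => ?_⟩, fun {a b} => ?_⟩, fun p hp => ?_⟩
  · exact (pair _ (hxI _) _ (hxI _) _ (hK (F a)) _ (hF a)).1.2 rfl
  · exact (pair _ (hxI _) _ (hxI _) _ (hF (K b)) _ (hK b)).1.1 rfl
  · exact (pair _ (hxI _) _ (hxI _) _ (hF a) _ (hF b)).2.symm
  · exact (pair _ (hxI _) _ (Order.mem_idealOfCofinals f₀ D) _ (hF p.1) _ hp).1.1 rfl

theorem of_ext {V : Type*} [Countable V] {R : SimpleGraph V} (h : Ext R) :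
    IsCountableUniversalGraph R where
  countable := inferInstance
  universal _ _ := exists_embedding h
  homogeneous A B φ := by
    classical
    let g : ↥(A : Set V) → V × V := fun a => ((a : V), (φ a : V))
    obtain ⟨ψ, hψ⟩ := exists_iso h h ⟨(Finset.univ : Finset ↥(A : Set V)).image g, by
      intro p hp q hq
      obtain ⟨a, -, rfl⟩ := Finset.mem_image.1 hp
      obtain ⟨b, -, rfl⟩ := Finset.mem_image.1 hq
      constructor
      · change (a : V) = b ↔ (φ a : V) = φ b
        rw [Subtype.val_inj, Subtype.val_inj, φ.injective.eq_iff]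
      · exact (φ.map_adj_iff (v := a) (w := b)).symm⟩
    exact ⟨ψ, fun a => hψ (g a) (Finset.mem_image_of_mem g (Finset.mem_univ a))⟩

end CountableUniversalGraph

/-- The countable universal graph exists. -/
theorem exists_isCountableUniversalGraph :
    ∃ R : SimpleGraph ℕ, IsCountableUniversalGraph R := by
  classical
  let D : ℕ → Finset ℕ := fun n => ((Encodable.decode n.unpair.1 : Option (Finset ℕ))).getD ∅
  let R : SimpleGraph ℕ :=
    { Adj := fun a b => (a < b ∧ a ∈ D b) ∨ (b < a ∧ b ∈ D a)
      symm := ⟨fun a b h => h.symm⟩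
      loopless := ⟨fun a h => by simp at h⟩ }
  refine ⟨R, CountableUniversalGraph.of_ext fun A B hAB => ?_⟩
  let N := (A ∪ B).sup id + 1
  let z := Nat.pair (Encodable.encode A) N
  have hz : ∀ x ∈ A ∪ B, x < z := fun x hx =>
    lt_of_lt_of_le (Nat.lt_succ_of_le (Finset.le_sup (f := id) hx)) (Nat.right_le_pair _ _)
  have hD : D z = A := by simp [D, z]
  refine ⟨z, fun h => ?_, fun h => ?_, fun a ha => ?_, fun b hb h => ?_⟩
  · exact lt_irrefl _ (hz z (Finset.mem_union_left _ h))
  · exact lt_irrefl _ (hz z (Finset.mem_union_right _ h))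
  · exact Or.inl ⟨hz a (Finset.mem_union_left _ ha), hD.symm ▸ ha⟩
  · rcases h with ⟨-, h⟩ | ⟨h, -⟩
    · rw [hD] at h
      exact Finset.disjoint_left.1 hAB h hb
    · exact lt_asymm h (hz b (Finset.mem_union_right _ hb))

/-! ### Extension property and algebraic closure -/

namespace CountableUniversalGraph

/-! A back-and-forth argument gives a bijective homomorphism from `R` onto `Γ`
(`exists_bijective_hom`); followed by an induced embedding of `Γ` in `R`, it is an injective
endomorphism `f` with image a copy of `Γ`. Were `f` regular, it would reflect edges, so `R` would be
isomorphic to `Γ`. The class counts hold for every injective `f`. By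
`exists_embedding_extending_homs`, any countable graph embeds in `R` so that its homomorphisms to
`R` extend to endomorphisms. Doubling the vertices of `R` gives continuum many right multiples of
`f`, R-related to `f` but pairwise not L-related; adding isolated vertices to `R` gives left
multiples with the roles exchanged. There are only continuum many endomorphisms. -/

theorem _root_.IsCountableUniversalGraph.ext {V : Type*} {R : SimpleGraph V}
    (hR : IsCountableUniversalGraph R) : Ext R := by
  classical
  intro A B hAB
  let S : Finset V := A ∪ B
  -- The graph on `S` with a new vertex `none` joined exactly to `A`. It embeds in `R` by
  -- universality, and homogeneity moves the copy of `S` back onto `S`; the image of `none` is the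
  -- required vertex.
  let H : SimpleGraph (Option ↥(S : Set V)) :=
    { Adj := fun x y => match x, y with
        | some a, some b => R.Adj a b
        | some a, none => (a : V) ∈ A
        | none, some b => (b : V) ∈ A
        | none, none => False
      symm := ⟨fun x y h => by
        cases x <;> cases y <;> first | exact h | exact SimpleGraph.Adj.symm (G := R) h⟩
      loopless := ⟨fun x h => by
        cases x
        · exact h
        · exact R.irrefl h⟩ }
  let en := Fintype.equivFin (Option ↥(S : Set V))
  obtain ⟨θ'⟩ := hR.universal _ (H.map en.toEmbedding)
  let θ : H ↪g R := (SimpleGraph.Iso.map en H).toEmbedding.trans θ'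
  let u : ↥(S : Set V) → V := fun a => θ (some a)
  have hu : Function.Injective u := fun a b h => Option.some_injective _ (θ.injective h)
  let T : Finset V := Finset.univ.image u
  have hT : ∀ a, u a ∈ (T : Set V) := fun a =>
    Finset.mem_coe.2 (Finset.mem_image_of_mem u (Finset.mem_univ a))
  let eq : ↥(S : Set V) ≃ ↥(T : Set V) := Equiv.ofBijective (fun a => ⟨u a, hT a⟩)
    ⟨fun a b h => hu (congrArg Subtype.val h), fun ⟨t, ht⟩ => by
      obtain ⟨a, -, rfl⟩ := Finset.mem_image.1 (Finset.mem_coe.1 ht)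
      exact ⟨a, rfl⟩⟩
  let φ : R.induce (S : Set V) ≃g R.induce (T : Set V) :=
    ⟨eq, fun {a b} => θ.map_adj_iff (v := some a) (w := some b)⟩
  obtain ⟨ψ, hψ⟩ := hR.homogeneous T S φ.symm
  have hψu : ∀ a, ψ (u a) = a := fun a => by
    have h1 := hψ ⟨u a, hT a⟩
    have h2 : φ.symm ⟨u a, hT a⟩ = a := φ.symm_apply_apply a
    rw [h2] at h1
    exact h1
  have hadj : ∀ a : ↥(S : Set V), R.Adj a (ψ (θ none)) ↔ (a : V) ∈ A := fun a => by
    conv_lhs => rw [← hψu a]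
    rw [ψ.map_adj_iff]
    exact θ.map_adj_iff (v := some a) (w := none)
  have hne : ∀ a : ↥(S : Set V), (a : V) ≠ ψ (θ none) := fun a h => by
    rw [← hψu a] at h
    exact Option.some_ne_none a (θ.injective (ψ.injective h))
  have hSA : ∀ a ∈ A, a ∈ (S : Set V) := fun a ha => Finset.mem_coe.2 (Finset.mem_union_left _ ha)
  have hSB : ∀ b ∈ B, b ∈ (S : Set V) := fun b hb =>
    Finset.mem_coe.2 (Finset.mem_union_right _ hb)
  exact ⟨ψ (θ none), fun h => hne ⟨_, hSA _ h⟩ rfl, fun h => hne ⟨_, hSB _ h⟩ rfl,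
    fun a ha => (hadj ⟨a, hSA a ha⟩).2 ha,
    fun b hb h => Finset.disjoint_left.1 hAB ((hadj ⟨b, hSB b hb⟩).1 h) hb⟩

theorem Ext.isAlgClosedGraph {V : Type*} {R : SimpleGraph V} (h : Ext R) :
    IsAlgClosedGraph R := fun A => by
  obtain ⟨z, -, -, hz, -⟩ := h A ∅ (Finset.disjoint_empty_right A)
  exact ⟨z, fun a ha => (hz a ha).symm⟩

theorem _root_.IsAlgClosedGraph.infinite {V : Type*} {R : SimpleGraph V}
    (h : IsAlgClosedGraph R) : Infinite V := by
  refine ⟨fun hfin => ?_⟩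
  cases nonempty_fintype V
  obtain ⟨w, hw⟩ := h Finset.univ
  exact R.irrefl (hw w (Finset.mem_univ w))

/-! ### Extending homomorphisms to endomorphisms -/

/-- Add to a graph `G` countably many vertices, the `n`-th one being joined to the members of
the finite set `D n` among the vertices of `G` and the earlier new vertices. -/
def finiteExtension {W : Type*} (G : SimpleGraph W) (D : ℕ → Finset (W ⊕ ℕ)) :
    SimpleGraph (W ⊕ ℕ) where
  Adj x y := match x, y with
    | Sum.inl a, Sum.inl b => G.Adj a b
    | Sum.inl a, Sum.inr n => Sum.inl a ∈ D n
    | Sum.inr n, Sum.inl a => Sum.inl a ∈ D n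
    | Sum.inr k, Sum.inr n => (k < n ∧ Sum.inr k ∈ D n) ∨ (n < k ∧ Sum.inr n ∈ D k)
  symm := ⟨fun x y h => by
    rcases x with x | x <;> rcases y with y | y
    · exact SimpleGraph.Adj.symm (G := G) h
    · exact h
    · exact h
    · exact Or.symm h⟩
  loopless := ⟨fun x h => by
    rcases x with x | x
    · exact G.irrefl h
    · exact h.elim (fun h => lt_irrefl _ h.1) fun h => lt_irrefl _ h.1⟩

/-- Since `A` recurs in `D`, some vertex with prescribed set `A` comes after every new vertex in `A
∪ B`; its neighbours in `A ∪ B` are then exactly `A`. -/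
theorem finiteExtension_ext {W : Type*} (G : SimpleGraph W) (D : ℕ → Finset (W ⊕ ℕ))
    (hD : ∀ A N, ∃ n, N < n ∧ D n = A) : Ext (finiteExtension G D) := by
  classical
  intro A B hAB
  obtain ⟨z, hz, hzA⟩ := hD A ((A ∪ B).sup (Sum.elim (fun _ => 0) id))
  have hlt : ∀ k, Sum.inr k ∈ A ∪ B → k < z := fun k hk =>
    (Finset.le_sup (f := Sum.elim (fun _ => 0) id) hk).trans_lt hz
  have hadj : ∀ x ∈ A ∪ B, (finiteExtension G D).Adj x (Sum.inr z) ↔ x ∈ A := by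
    intro x hx
    rw [← hzA]
    rcases x with a | k
    · exact Iff.rfl
    · have := hlt k hx
      exact ⟨fun h => h.elim (fun h => h.2) fun h => absurd h.1 this.asymm,
        fun h => Or.inl ⟨this, h⟩⟩
  refine ⟨Sum.inr z, fun h => ?_, fun h => ?_, fun a ha => ?_, fun b hb h => ?_⟩
  · exact lt_irrefl _ (hlt z (Finset.mem_union_left _ h))
  · exact lt_irrefl _ (hlt z (Finset.mem_union_right _ h))
  · exact (hadj a (Finset.mem_union_left _ ha)).2 ha
  · exact Finset.disjoint_left.1 hAB ((hadj b (Finset.mem_union_right _ hb)).1 h) hb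

/-- Recursively, the `n`-th new vertex goes to a common neighbour of the images of `D n`. -/
theorem finiteExtension_extend_hom {V W : Type*} {R : SimpleGraph V} (hR : IsAlgClosedGraph R)
    (G : SimpleGraph W) (D : ℕ → Finset (W ⊕ ℕ)) (h : G →g R) :
    ∃ m : finiteExtension G D →g R, ∀ w, m (Sum.inl w) = h w := by
  classical
  choose c hc using hR
  let step : (n : ℕ) → ((k : ℕ) → k < n → V) → V := fun n F =>
    -- Members of `D n` with index at least `n` give no edge, so their value `c ∅` is arbitrary.
    c ((D n).image (Sum.elim h fun k => if hk : k < n then F k hk else c ∅))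
  let F : ℕ → V := Nat.lt_wfRel.wf.fix step
  have hF : ∀ n, F n = step n fun k _ => F k := fun n => Nat.lt_wfRel.wf.fix_eq step n
  have hl : ∀ n w, Sum.inl w ∈ D n → R.Adj (F n) (h w) := fun n w hw => by
    rw [hF]
    exact hc _ _ (Finset.mem_image.2 ⟨_, hw, rfl⟩)
  have hr : ∀ n k, k < n → Sum.inr k ∈ D n → R.Adj (F n) (F k) := fun n k hk hw => by
    rw [hF n]
    exact hc _ _ (Finset.mem_image.2 ⟨_, hw, dif_pos hk⟩)
  refine ⟨⟨Sum.elim h F, fun {x y} hxy => ?_⟩, fun w => rfl⟩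
  rcases x with a | k <;> rcases y with b | n
  · exact h.map_adj hxy
  · exact (hl n a hxy).symm
  · exact hl k b hxy
  · exact hxy.elim (fun h => (hr n k h.1 h.2).symm) fun h => hr k n h.1 h.2

/-- Every countable graph has an embedding in `R` along which all homomorphisms to `R` extend. -/
theorem exists_embedding_extending_homs {V W : Type*} [Countable V] [Countable W]
    {R : SimpleGraph V} (hR : Ext R) (G : SimpleGraph W) :
    ∃ j : G ↪g R, ∀ h : G →g R, ∃ m : R →g R, ∀ w, m (j w) = h w := by
  classical
  cases nonempty_encodable W
  let D : ℕ → Finset (W ⊕ ℕ) := fun n =>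
    ((Encodable.decode n.unpair.1 : Option (Finset (W ⊕ ℕ)))).getD ∅
  have hD : ∀ A N, ∃ n, N < n ∧ D n = A := fun A N =>
    ⟨Nat.pair (Encodable.encode A) (N + 1), (Nat.right_le_pair _ _).trans_lt' N.lt_succ_self,
      by simp [D]⟩
  obtain ⟨ψ, -⟩ := exists_iso (finiteExtension_ext G D hD) hR ⟨∅, by simp⟩
  let i : G ↪g finiteExtension G D := ⟨⟨Sum.inl, Sum.inl_injective⟩, Iff.rfl⟩
  refine ⟨i.trans ψ.toEmbedding, fun h => ?_⟩
  obtain ⟨m, hm⟩ := finiteExtension_extend_hom hR.isAlgClosedGraph G D h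
  refine ⟨m.comp ψ.symm.toHom, fun w => ?_⟩
  rw [← hm w]
  exact congrArg m (ψ.symm_apply_apply (i w))

/-! ### Bijective homomorphisms by back-and-forth -/

/-- Finite partial injective homomorphisms, as finite sets of pairs. -/
abbrev PHom {V W : Type*} (G : SimpleGraph V) (H : SimpleGraph W) : Type _ :=
  {f : Finset (V × W) // ∀ p ∈ f, ∀ q ∈ f,
    (p.1 = q.1 ↔ p.2 = q.2) ∧ (G.Adj p.1 q.1 → H.Adj p.2 q.2)}

theorem PHom.exists_insert {V W : Type*} {G : SimpleGraph V} {H : SimpleGraph W} (f : PHom G H)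
    (a : V) (b : W)
    (h : ∀ p ∈ f.1, p.1 ≠ a ∧ p.2 ≠ b ∧ (G.Adj p.1 a → H.Adj p.2 b)) :
    ∃ g : PHom G H, (a, b) ∈ g.1 ∧ f ≤ g := by
  classical
  refine ⟨⟨insert (a, b) f.1, fun p hp q hq => ?_⟩, Finset.mem_insert_self _ _,
    Finset.subset_insert _ _⟩
  rw [Finset.mem_insert] at hp hq
  rcases hp with rfl | hp <;> rcases hq with rfl | hq
  · simp
  · obtain ⟨h1, h2, h3⟩ := h q hq
    exact ⟨iff_of_false h1.symm h2.symm, fun e => (h3 e.symm).symm⟩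
  · obtain ⟨h1, h2, h3⟩ := h p hp
    exact ⟨iff_of_false h1 h2, h3⟩
  · exact f.2 p hp q hq

theorem PHom.forth {V W : Type*} {G : SimpleGraph V} {H : SimpleGraph W}
    (hH : IsAlgClosedGraph H) (f : PHom G H) (a : V) :
    ∃ g : PHom G H, (∃ b, (a, b) ∈ g.1) ∧ f ≤ g := by
  classical
  by_cases h : ∃ b, (a, b) ∈ f.1
  · exact ⟨f, h, le_rfl⟩
  push Not at h
  obtain ⟨w, hw⟩ := hH (f.1.image Prod.snd)
  have hw' : ∀ p ∈ f.1, H.Adj p.2 w := fun p hp => (hw _ (Finset.mem_image_of_mem _ hp)).symm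
  obtain ⟨g, hg, hfg⟩ := f.exists_insert a w fun p hp =>
    ⟨fun e => h p.2 (e ▸ hp), (hw' p hp).ne, fun _ => hw' p hp⟩
  exact ⟨g, ⟨w, hg⟩, hfg⟩

/-- A new preimage adjacent to nothing in the domain makes the edge condition vacuous, so nothing is
needed of `H`. -/
theorem PHom.back {V W : Type*} {G : SimpleGraph V} {H : SimpleGraph W}
    (hG : Ext G) (f : PHom G H) (b : W) :
    ∃ g : PHom G H, (∃ a, (a, b) ∈ g.1) ∧ f ≤ g := by
  classical
  by_cases h : ∃ a, (a, b) ∈ f.1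
  · exact ⟨f, h, le_rfl⟩
  push Not at h
  obtain ⟨z, -, hz, -, hadj⟩ := hG ∅ (f.1.image Prod.fst) (Finset.disjoint_empty_left _)
  obtain ⟨g, hg, hfg⟩ := f.exists_insert z b fun p hp =>
    ⟨fun e => hz (e ▸ Finset.mem_image_of_mem _ hp), fun e => h p.1 (e ▸ hp),
      fun e => absurd e (hadj _ (Finset.mem_image_of_mem _ hp))⟩
  exact ⟨g, ⟨z, hg⟩, hfg⟩

/-- A countable algebraically closed graph is a bijective homomorphic image of `R`. -/
theorem exists_bijective_hom {V W : Type*} [Countable V] [Countable W] {G : SimpleGraph V}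
    {H : SimpleGraph W} (hG : Ext G) (hH : IsAlgClosedGraph H) :
    ∃ b : G →g H, Function.Bijective b := by
  cases nonempty_encodable V
  cases nonempty_encodable W
  let f₀ : PHom G H := ⟨∅, by simp⟩
  let D : V ⊕ W → Order.Cofinal (PHom G H) := fun s => Sum.recOn s
    (fun a => ⟨{g | ∃ b, (a, b) ∈ g.1}, fun f => PHom.forth hH f a⟩)
    (fun b => ⟨{g | ∃ a, (a, b) ∈ g.1}, fun f => PHom.back hG f b⟩)
  choose x hx hxI using Order.cofinal_meets_idealOfCofinals f₀ D
  have hl : ∀ a : V, ∃ b, (a, b) ∈ (x (Sum.inl a)).1 := fun a => hx (Sum.inl a)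
  have hr : ∀ b : W, ∃ a, (a, b) ∈ (x (Sum.inr b)).1 := fun b => hx (Sum.inr b)
  choose F hF using hl
  have pair : ∀ s t, ∀ p ∈ (x s).1, ∀ q ∈ (x t).1,
      (p.1 = q.1 ↔ p.2 = q.2) ∧ (G.Adj p.1 q.1 → H.Adj p.2 q.2) := by
    intro s t p hp q hq
    obtain ⟨m, -, h1, h2⟩ := (Order.idealOfCofinals f₀ D).directed _ (hxI s) _ (hxI t)
    exact m.2 _ (h1 hp) _ (h2 hq)
  refine ⟨⟨F, fun {a b} h => (pair _ _ _ (hF a) _ (hF b)).2 h⟩,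
    fun a b h => (pair _ _ _ (hF a) _ (hF b)).1.2 h, fun b => ?_⟩
  obtain ⟨a, ha⟩ := hr b
  exact ⟨a, (pair _ _ _ (hF a) _ ha).1.1 rfl⟩

end CountableUniversalGraph

/-! ### Green's relations and class counts -/

section Green

variable {M : Type*} [Monoid M]

theorem greenL_of_eq_mul {f g m n : M} (hg : g = m * f) (hf : f = n * g) : GreenL f g := by
  apply Set.Subset.antisymm
  · rintro _ ⟨k, rfl⟩
    exact ⟨k * n, by dsimp only; rw [mul_assoc, ← hf]⟩
  · rintro _ ⟨k, rfl⟩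
    exact ⟨k * m, by dsimp only; rw [mul_assoc, ← hg]⟩

theorem greenR_of_eq_mul {f g m n : M} (hg : g = f * m) (hf : f = g * n) : GreenR f g := by
  apply Set.Subset.antisymm
  · rintro _ ⟨k, rfl⟩
    exact ⟨n * k, by dsimp only; rw [← mul_assoc, ← hf]⟩
  · rintro _ ⟨k, rfl⟩
    exact ⟨m * k, by dsimp only; rw [← mul_assoc, ← hg]⟩

theorem GreenL.exists_eq_mul {f g : M} (h : GreenL f g) : ∃ m, f = m * g := by
  have : f ∈ Set.range fun m : M => m * g := h ▸ ⟨1, one_mul f⟩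
  obtain ⟨m, hm⟩ := this
  exact ⟨m, hm.symm⟩

theorem GreenR.exists_eq_mul {f g : M} (h : GreenR f g) : ∃ m, f = g * m := by
  have : f ∈ Set.range fun m : M => g * m := h ▸ ⟨1, mul_one f⟩
  obtain ⟨m, hm⟩ := this
  exact ⟨m, hm.symm⟩

theorem mk_lClassesOfDClass_le (f : M) : Cardinal.mk (lClassesOfDClass f) ≤ Cardinal.mk M :=
  (Cardinal.mk_le_mk_of_subset (t := Set.range fun g : M => {h | GreenL g h})
    (by rintro _ ⟨g, -, rfl⟩; exact ⟨g, rfl⟩)).trans Cardinal.mk_range_le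

theorem mk_rClassesOfDClass_le (f : M) : Cardinal.mk (rClassesOfDClass f) ≤ Cardinal.mk M :=
  (Cardinal.mk_le_mk_of_subset (t := Set.range fun g : M => {h | GreenR g h})
    (by rintro _ ⟨g, -, rfl⟩; exact ⟨g, rfl⟩)).trans Cardinal.mk_range_le

theorem le_mk_lClassesOfDClass {I : Type _} (f : M) (g : I → M) (hg : ∀ i, GreenR f (g i))
    (hinj : ∀ i j, GreenL (g i) (g j) → i = j) :
    Cardinal.mk I ≤ Cardinal.mk (lClassesOfDClass f) := by
  refine Cardinal.mk_le_of_injective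
    (f := fun i => ⟨{h | GreenL (g i) h}, g i, ⟨f, rfl, hg i⟩, rfl⟩) fun i j h => hinj i j ?_
  have h' : {k | GreenL (g i) k} = {k | GreenL (g j) k} := congrArg Subtype.val h
  have : g j ∈ {k | GreenL (g i) k} := by rw [h']; exact rfl
  exact this

theorem le_mk_rClassesOfDClass {I : Type _} (f : M) (g : I → M) (hg : ∀ i, GreenL f (g i))
    (hinj : ∀ i j, GreenR (g i) (g j) → i = j) :
    Cardinal.mk I ≤ Cardinal.mk (rClassesOfDClass f) := by
  refine Cardinal.mk_le_of_injective
    (f := fun i => ⟨{h | GreenR (g i) h}, g i, ⟨g i, hg i, rfl⟩, rfl⟩) fun i j h => hinj i j ?_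
  have h' : {k | GreenR (g i) k} = {k | GreenR (g j) k} := congrArg Subtype.val h
  have : g j ∈ {k | GreenR (g i) k} := by rw [h']; exact rfl
  exact this

end Green

/-! ### Counting classes in the endomorphism monoid -/

namespace GraphEnd

open CountableUniversalGraph

theorem ext_apply {V : Type*} {R : SimpleGraph V} {f g : GraphEnd R}
    (h : ∀ v, f.unop v = g.unop v) : f = g :=
  MulOpposite.unop_injective (RelHom.ext h)

theorem mk_le_continuum {V : Type*} [Countable V] (R : SimpleGraph V) :
    Cardinal.mk (GraphEnd R) ≤ Cardinal.continuum := by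
  have h : Function.Injective fun f : GraphEnd R => (f.unop : V → V) :=
    fun f g h => ext_apply (congrFun h)
  refine (Cardinal.mk_le_of_injective h).trans ?_
  rw [← Cardinal.power_def, ← Cardinal.aleph0_power_aleph0]
  exact (Cardinal.power_le_power_right Cardinal.mk_le_aleph0).trans
    (Cardinal.power_le_power_left Cardinal.aleph0_ne_zero Cardinal.mk_le_aleph0)

/-- Send `vf` to its copy labelled `s v` in the doubled graph; the extended projection `n` undoes
this. An L-relation between two such maps must come from the identity, by first coordinates and
injectivity of `f`, so the labellings agree. -/
theorem continuum_le_mk_lClassesOfDClass {V : Type*} [Countable V] {R : SimpleGraph V}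
    (hR : Ext R) (f : GraphEnd R) (hf : Function.Injective f.unop) :
    Cardinal.continuum ≤ Cardinal.mk (lClassesOfDClass f) := by
  have := hR.isAlgClosedGraph.infinite
  obtain ⟨j, hj⟩ := exists_embedding_extending_homs hR (R.comap (Prod.fst : V × Bool → V))
  obtain ⟨n, hn⟩ := hj ⟨Prod.fst, fun h => h⟩
  let m : (V → Bool) → GraphEnd R := fun s =>
    MulOpposite.op ⟨fun v => j (v, Function.extend f.unop s (fun _ => false) v), fun {a b} h =>
      j.map_adj_iff.2 (show R.Adj a b from h)⟩
  have hm : ∀ s v, (f * m s).unop v = j (f.unop v, s v) := fun s v =>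
    congrArg (fun i => j (f.unop v, i)) (hf.extend_apply s _ v)
  have key := le_mk_lClassesOfDClass f (fun s => f * m s)
    (fun s => greenR_of_eq_mul (n := MulOpposite.op n) rfl
      (ext_apply fun v => by rw [GraphEnd.mul_apply, hm]; exact (hn (_, _)).symm))
    (fun s t h => by
      obtain ⟨k, hk⟩ := h.exists_eq_mul
      funext v
      have h1 := congrArg (fun g : GraphEnd R => g.unop v) hk
      simp only [GraphEnd.mul_apply k, hm] at h1
      have h2 := j.injective h1
      have h3 : v = k.unop v := hf (congrArg Prod.fst h2)
      rw [← h3] at h2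
      exact congrArg Prod.snd h2)
  rwa [Cardinal.mk_arrow, Cardinal.mk_eq_aleph0 V, Cardinal.mk_bool, Cardinal.lift_aleph0, Cardinal.lift_two,
    Cardinal.two_power_aleph0] at key

/-- `m φ` is the identity on a copy of `R` and `φ` on the isolated vertices. R-related maps have
equal kernels, and as `f` is injective the kernel of `m φ * f` determines `φ`. -/
theorem continuum_le_mk_rClassesOfDClass {V : Type*} [Countable V] {R : SimpleGraph V}
    (hR : Ext R) (f : GraphEnd R) (hf : Function.Injective f.unop) :
    Cardinal.continuum ≤ Cardinal.mk (rClassesOfDClass f) := by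
  have := hR.isAlgClosedGraph.infinite
  obtain ⟨j, hj⟩ := exists_embedding_extending_homs hR (R ⊕g (⊥ : SimpleGraph V))
  have hext : ∀ φ : V → V, ∃ m : R →g R,
      ∀ w, m (j w) = (Sum.elim id φ : V ⊕ V → V) w := fun φ =>
    hj ⟨Sum.elim id φ, fun {a b} h => by
      rcases a with a | a <;> rcases b with b | b <;> simp_all⟩
  choose m hm using hext
  let n : R →g R := ⟨fun v => j (Sum.inl v), fun {a b} h => j.map_adj_iff.2 (by simpa using h)⟩
  have key := le_mk_rClassesOfDClass f (fun φ => MulOpposite.op (m φ) * f)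
    (fun φ => greenL_of_eq_mul (n := MulOpposite.op n) rfl
      (ext_apply fun v => congrArg f.unop (hm φ (Sum.inl v)).symm))
    (fun φ χ h => by
      obtain ⟨k, hk⟩ := GreenR.exists_eq_mul (Eq.symm h)
      funext v
      have h1 : ∀ x, f.unop (m χ x) = k.unop (f.unop (m φ x)) := fun x =>
        congrArg (fun g : GraphEnd R => g.unop x) hk
      have h2 : m φ (j (Sum.inr v)) = m φ (j (Sum.inl (φ v))) :=
        (hm φ (Sum.inr v)).trans (hm φ (Sum.inl (φ v))).symm
      have h3 : m χ (j (Sum.inr v)) = m χ (j (Sum.inl (φ v))) := hf (by rw [h1, h1, h2])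
      rw [hm, hm] at h3
      exact h3.symm)
  rwa [← Cardinal.power_def, Cardinal.mk_eq_aleph0 V, Cardinal.aleph0_power_aleph0] at key

/-- A regular injective endomorphism is an isomorphism onto its image. -/
theorem nonempty_iso_induce_range {V : Type*} {R : SimpleGraph V} {f : GraphEnd R}
    (hreg : IsRegularElt f) (hf : Function.Injective f.unop) :
    Nonempty (R ≃g R.induce (Set.range f.unop)) := by
  obtain ⟨g, hg⟩ := hreg
  -- Cancelling the injective last factor in `f * g * f = f` leaves `f * g = 1`.
  have hgf : ∀ v, g.unop (f.unop v) = v := fun v =>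
    hf (congrArg (fun h : GraphEnd R => h.unop v) hg)
  refine ⟨⟨Equiv.ofInjective _ hf, fun {a b} => ⟨fun h => ?_, fun h => f.unop.map_adj h⟩⟩⟩
  rw [← hgf a, ← hgf b]
  exact g.unop.map_adj h

end GraphEnd

open CountableUniversalGraph in
theorem mainTheorem6 {V : Type*} {W : Type*} (R : SimpleGraph V)
    (hR : IsCountableUniversalGraph R) (Γ : SimpleGraph W) (hΓcount : Countable W)
    (hΓ : IsAlgClosedGraph Γ) (hne : IsEmpty (Γ ≃g R)) :
    ∃ f : GraphEnd R, ¬ IsRegularElt f ∧ Function.Injective f.unop ∧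
      Nonempty (R.induce (Set.range f.unop) ≃g Γ) ∧
      Cardinal.mk (rClassesOfDClass f) = Cardinal.continuum ∧
      Cardinal.mk (lClassesOfDClass f) = Cardinal.continuum := by
  have := hR.countable
  have hE := hR.ext
  obtain ⟨b, hb⟩ := exists_bijective_hom hE hΓ
  obtain ⟨e⟩ := exists_embedding (G := Γ) hE
  let f : GraphEnd R := MulOpposite.op (e.toHom.comp b)
  have hf : Function.Injective f.unop := e.injective.comp hb.1
  have hrange : ∀ w, e w ∈ Set.range f.unop := fun w => by
    obtain ⟨v, rfl⟩ := hb.2 w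
    exact ⟨v, rfl⟩
  let iso : Γ ≃g R.induce (Set.range f.unop) :=
    ⟨Equiv.ofBijective (fun w => ⟨e w, hrange w⟩)
      ⟨fun a c h => e.injective (congrArg Subtype.val h), by
        rintro ⟨_, v, rfl⟩
        exact ⟨b v, rfl⟩⟩, e.map_adj_iff⟩
  refine ⟨f, fun hreg => ?_, hf, ⟨iso.symm⟩, ?_, ?_⟩
  · obtain ⟨i⟩ := GraphEnd.nonempty_iso_induce_range hreg hf
    exact hne.false (iso.trans i.symm)
  · exact ((mk_rClassesOfDClass_le f).trans (GraphEnd.mk_le_continuum R)).antisymm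
      (GraphEnd.continuum_le_mk_rClassesOfDClass hE f hf)
  · exact ((mk_lClassesOfDClass_le f).trans (GraphEnd.mk_le_continuum R)).antisymm
      (GraphEnd.continuum_le_mk_lClassesOfDClass hE f hf)
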